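/- Let $k$ be a field of characteristic $0$ and let $\mathcal E$ be a category with finite products (for instance a topos that is a model of synthetic differential geometry). Let $R$ be a commutative $k$-algebra object of $\mathcal E$, the line. Everything is expressed by generalized elements (elements at a stage $I\in\mathcal E$, natural under change of stage); a map $A\to B$ of functors of points defined at stage $I$ is a family of maps from $A(J)$ to $B(J)$, one for each $f\colon J\to I$, natural in $(J,f)$. A Weil algebra is a finite-dimensional commutative $k$-algebra $W$ with an augmentation $W\to k$ whose kernel is nilpotent; $\operatorname{Spec}W$ has the $k$-algebra homomorphisms $W\to \operatorname{Hom}(J,R)$ as its elements at stage $J$, and $M^{\operatorname{Spec}W}$ has the maps $\operatorname{Spec}W\to M$ at stage $I$ as its elements at stage $I$. Assume the Kock–Lawvere axiom: for every Weil algebra $W$ the canonical map $R\otimes W\to R^{\operatorname{Spec}W}$, $x\otimes w\mapsto(p\mapsto x\,p(w))$, is bijective at every stage. Put $D=\{d\in R\mid d^2=0\}$ and $D(2)=\{(a,b)\in D\times D\mid ab=0\}$. Let $G$ be a Lie group, i.e. a group object of $\mathcal E$ that is microlinear: for every cone of Weil algebras over a finite diagram of Weil algebras that is a limit cone of $k$-algebras,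 the induced cone of the $G^{\operatorname{Spec}W}$ is a limit cone. Let $\mathfrak g=T_eG$ be its Lie algebra, whose elements are the maps $X\colon D\to G$, $d\mapsto X_d$, with $X_0=e$. Its operations are: $(rX)_d=X_{rd}$; $(X+Y)_d=l(d,d)$ for the unique map $l\colon D(2)\to G$ with $l(d,0)=X_d$ and $l(0,d)=Y_d$; and $[X,Y]$ is the unique element with $[X,Y]_{ab}=X_aY_bX_a^{-1}Y_b^{-1}$ for all $a,b\in D$. Assume that $G$ has an exponential mapping, i.e. let $\exp\colon\mathfrak g\to G$ be a map such that for every $X\in\mathfrak g$ the map $t\mapsto\exp(tX)$ is a one-parameter subgroup, $\exp((s+t)X)=\exp(sX)\exp(tX)$ for all $s,t\in R$, with tangent vector $X$ at $0$, $\exp(dX)=X_d$ for $d\in D$. Then for all $X,Y\in\mathfrak g$ and all $d_1,d_2,d_3,d_4\in D$ (at any stage), with $s=d_1+d_2+d_3+d_4$, $$\exp(sX)\cdot\exp(sY)=\exp\Bigl(s(X+Y)+\tfrac12 s^2[X,Y]+\tfrac1{12}s^3[[X,Y],Y-X]+\tfrac1{96}s^4\bigl([X+Y,[[X,Y],X+Y]]+[[[X,Y],X-Y],X-Y]\bigr)\Bigr).$$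 -/

import Mathlib

open CategoryTheory MonoidalCategory CartesianMonoidalCategory
open scoped MonObj AddMonObj CommRingObj TensorProduct

universe w v u

namespace SDG

/-- A Weil algebra over the field `k`: a finite-dimensional commutative `k`-algebra with an
augmentation to `k` whose kernel consists of nilpotent elements (finite-dimensionality makes
the kernel a nilpotent ideal). -/
structure WeilAlg (k : Type w) [Field k] where
  carrier : Type w
  [commRing : CommRing carrier]
  [algebra : Algebra k carrier]
  finite : Module.Finite k carrier
  augmentation : ∃ p : carrier →ₐ[k] k, ∀ x, p x = 0 → IsNilpotent x

namespace WeilAlg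

instance (k : Type w) [Field k] : CoeSort (WeilAlg k) (Type w) := ⟨carrier⟩

instance {k : Type w} [Field k] (W : WeilAlg k) : CommRing W := W.commRing

instance {k : Type w} [Field k] (W : WeilAlg k) : Algebra k W := W.algebra

end WeilAlg

/-- A commutative `k`-algebra object: a commutative ring object `R` together with a ring
homomorphism from `k` to the ring of global elements of `R`. -/
class AlgObj (k : Type w) [Field k] {E : Type u} [Category.{v} E] [CartesianMonoidalCategory E]
    [BraidedCategory E] (R : E) [CommRingObj R] where
  scalar : k →+* (𝟙_ E ⟶ R)

section Line

variable {E : Type u} [Category.{v} E] [CartesianMonoidalCategory E] [BraidedCategory E]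
variable (R : E) [CommRingObj R]

/-- Change of stage along `f : J ⟶ I`, as a ring homomorphism between generalized elements. -/
def restrictRing {I J : E} (f : J ⟶ I) : (I ⟶ R) →+* (J ⟶ R) where
  toFun x := f ≫ x
  map_one' := MonObj.comp_one f
  map_mul' := MonObj.comp_mul f
  map_zero' := AddMonObj.comp_zero f
  map_add' := AddMonObj.comp_add f

variable (k : Type w) [Field k] [AlgObj k R]

/-- The generalized elements of `R` at each stage form a `k`-algebra. -/
instance algebraHom (I : E) : Algebra k (I ⟶ R) :=
  ((restrictRing R (toUnit I)).comp (AlgObj.scalar (k := k) (R := R))).toAlgebra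

/-- Change of stage as a homomorphism of `k`-algebras. -/
def restrict {I J : E} (f : J ⟶ I) : (I ⟶ R) →ₐ[k] (J ⟶ R) where
  __ := restrictRing R f
  commutes' c := by
    change f ≫ toUnit I ≫ AlgObj.scalar c = toUnit J ≫ AlgObj.scalar c
    rw [← Category.assoc, toUnit_unique (f ≫ toUnit I) (toUnit J)]

@[simp] theorem restrict_apply {I J : E} (f : J ⟶ I) (x : I ⟶ R) :
    restrict R k f x = f ≫ x := rfl

variable {R k} in
theorem restrict_id_comp {A : Type*} [CommRing A] [Algebra k A] {I : E}
    (p : A →ₐ[k] (I ⟶ R)) : (restrict R k (𝟙 I)).comp p = p := by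
  ext x; simp

end Line

section Prolongation

variable {E : Type u} [Category.{v} E] [CartesianMonoidalCategory E] [BraidedCategory E]
variable (k : Type w) [Field k] (R : E) [CommRingObj R] [AlgObj k R]

/-- The generalized elements at stage `I` of the exponential `M ^ Spec W`, where the
infinitesimal object `Spec W` has the `k`-algebra homomorphisms `W → (J ⟶ R)` as its generalized
elements at stage `J`. By the Yoneda lemma the families below are the morphisms
`I × Spec W ⟶ M` whenever `Spec W` is representable. -/
@[ext] structure Prolong (M : E) (W : Type w) [CommRing W] [Algebra k W] (I : E) where
  app : ∀ ⦃J : E⦄, (J ⟶ I) → (W →ₐ[k] (J ⟶ R)) → (J ⟶ M)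
  naturality : ∀ ⦃J K : E⦄ (g : K ⟶ J) (f : J ⟶ I) (p : W →ₐ[k] (J ⟶ R)),
    app (g ≫ f) ((restrict R k g).comp p) = g ≫ app f p

variable {k R}

/-- A homomorphism `W → W'` induces `Spec W' ⟶ Spec W`, and hence `M ^ Spec W ⟶ M ^ Spec W'`. -/
def Prolong.map {M : E} {W W' : Type w} [CommRing W] [Algebra k W] [CommRing W'] [Algebra k W']
    {I : E} (t : Prolong k R M W I) (a : W →ₐ[k] W') : Prolong k R M W' I where
  app _ f p := t.app f (p.comp a)
  naturality _ _ g f p := t.naturality g f (p.comp a)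

variable (k R)

/-- The canonical map from `R ⊗ W` to `R ^ Spec W`, on generalized elements at stage `I`:
`x ⊗ w` goes to the function `p ↦ x * p w` on `Spec W`. -/
def kockLawvereMap (W : Type w) [CommRing W] [Algebra k W] (I : E) (z : (I ⟶ R) ⊗[k] W) :
    Prolong k R R W I where
  app _ f p := Algebra.TensorProduct.lift (restrict R k f) p (fun _ _ => Commute.all _ _) z
  naturality J K g f p := by
    induction z using TensorProduct.induction_on with
    | zero => simp only [map_zero]; exact (map_zero (restrict R k g)).symm
    | tmul x y =>
      simp only [Algebra.TensorProduct.lift_tmul]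
      exact (by simp : (restrict R k (g ≫ f)) x * (restrict R k g) (p y) =
        restrict R k g (restrict R k f x) * restrict R k g (p y)).trans
          (map_mul (restrict R k g) _ _).symm
    | add x y hx hy =>
      simp only [map_add, hx, hy]
      exact (map_add (restrict R k g) _ _).symm

/-- The general Kock–Lawvere axiom for the line object `R`: for every Weil algebra `W` the
canonical morphism from `R ⊗ W` to `R ^ Spec W` is an isomorphism. -/
class KockLawvere : Prop where
  bijective : ∀ (W : WeilAlg k) (I : E), Function.Bijective (kockLawvereMap k R W I)

/-- `M` is microlinear: for every finite diagram of Weil algebras (with vertices `V` and edges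
`Q`) and every cone over it that has a Weil algebra `W` as vertex and is a limit of
`k`-algebras, `M ^ Spec W` is the limit of the diagram of the objects `M ^ Spec (A a)`. -/
class Microlinear (M : E) : Prop where
  isLimit : ∀ (V Q : Type) [Finite V] [Finite Q] (src tgt : Q → V) (A : V → WeilAlg k)
    (F : ∀ q, A (src q) →ₐ[k] A (tgt q)) (W : WeilAlg k) (π : ∀ a, W →ₐ[k] A a),
    (∀ q, (F q).comp (π (src q)) = π (tgt q)) →
    (∀ y : ∀ a, A a, (∀ q, F q (y (src q)) = y (tgt q)) → ∃! x : W, ∀ a, π a x = y a) →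
    ∀ (I : E) (t : ∀ a, Prolong k R M (A a) I), (∀ q, (t (src q)).map (F q) = t (tgt q)) →
      ∃! s : Prolong k R M W I, ∀ a, s.map (π a) = t a

end Prolongation

section Infinitesimals

variable {E : Type u} [Category.{v} E] [CartesianMonoidalCategory E] [BraidedCategory E]

/-- The generalized elements at stage `J` of `D = {d ∈ R | d ^ 2 = 0}`. -/
def D (R : E) [CommRingObj R] (J : E) : Type v := {d : J ⟶ R // d ^ 2 = 0}

namespace D

variable {R : E} [CommRingObj R] {I J K : E}

/-- The underlying generalized element of the line. -/
def val (d : D R J) : J ⟶ R := Subtype.val d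

theorem sq (d : D R J) : d.val ^ 2 = 0 := Subtype.property d

@[ext] theorem ext {d e : D R J} (h : d.val = e.val) : d = e := Subtype.ext h

instance : Zero (D R J) := ⟨⟨0, by simp⟩⟩

instance : Neg (D R J) := ⟨fun d => ⟨-d.val, by rw [neg_sq, d.sq]⟩⟩

/-- Multiplication of an element of `D` by an element of the line. -/
instance : SMul (J ⟶ R) (D R J) := ⟨fun r d => ⟨r * d.val, by rw [mul_pow, d.sq, mul_zero]⟩⟩

instance : Mul (D R J) := ⟨fun d e => ⟨d.val * e.val, by rw [mul_pow, d.sq, zero_mul]⟩⟩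

/-- Change of stage. -/
def res (g : K ⟶ J) (d : D R J) : D R K :=
  ⟨g ≫ d.val, ((map_pow (restrictRing R g) d.val 2).symm.trans
    (congrArg (restrictRing R g) d.sq)).trans (map_zero (restrictRing R g))⟩

@[simp] theorem val_mk (x : J ⟶ R) (h : x ^ 2 = 0) : val (⟨x, h⟩ : D R J) = x := rfl
@[simp] theorem val_zero : (0 : D R J).val = 0 := rfl
@[simp] theorem val_neg (d : D R J) : (-d).val = -d.val := rfl
@[simp] theorem val_smul (r : J ⟶ R) (d : D R J) : (r • d).val = r * d.val := rfl
@[simp] theorem val_mul (d e : D R J) : (d * e).val = d.val * e.val := rfl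
@[simp] theorem val_res (g : K ⟶ J) (d : D R J) : (d.res g).val = g ≫ d.val := rfl

end D

end Infinitesimals

section LieAlgebra

variable {E : Type u} [Category.{v} E] [CartesianMonoidalCategory E] [BraidedCategory E]

/-- The generalized elements at stage `I` of the tangent space `𝔤 = T_e G`: maps
`d ∈ D ↦ X_d ∈ G` with `X_0 = e`. As above, such a map defined at stage `I` is a natural
family, which is the same as a morphism `I × D ⟶ G` when `D` is representable. The field `k` is
the one over which Weil algebras are taken. -/
@[ext] structure Tangent (k : Type w) [Field k] (R : E) [CommRingObj R] [AlgObj k R] (G : E)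
    [GrpObj G] (I : E) where
  app : ∀ ⦃J : E⦄, (J ⟶ I) → D R J → (J ⟶ G)
  naturality : ∀ ⦃J K : E⦄ (g : K ⟶ J) (f : J ⟶ I) (d : D R J),
    app (g ≫ f) (d.res g) = g ≫ app f d
  app_zero : ∀ ⦃J : E⦄ (f : J ⟶ I), app f 0 = 1

namespace Tangent

variable {k : Type w} [Field k] {R : E} [CommRingObj R] [AlgObj k R] {G : E} [GrpObj G]
variable {I J : E}

/-- Change of stage. -/
def res (g : J ⟶ I) (X : Tangent k R G I) : Tangent k R G J where
  app _ f d := X.app (f ≫ g) d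
  naturality _ _ h f d := by rw [Category.assoc, X.naturality]
  app_zero _ f := X.app_zero _

/-- Scalar multiplication on `𝔤`: `(r X)_d = X_{r d}`. -/
instance : SMul (I ⟶ R) (Tangent k R G I) where
  smul r X :=
    { app := fun _ f d => X.app f ((f ≫ r) • d)
      naturality := fun _ _ g f d => by
        rw [← X.naturality]
        congr 1
        ext
        simp [MonObj.comp_mul]
      app_zero := fun _ f => by
        rw [← X.app_zero f]
        congr 1
        ext
        simp }

/-- `Z` is the sum of the tangent vectors `X` and `Y`: there is a map `l` on
`D(2) = {(a, b) ∈ D × D | a b = 0}` with `l (d, 0) = X_d`, `l (0, d) = Y_d` and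
`l (d, d) = Z_d`. -/
def IsSum (X Y Z : Tangent k R G I) : Prop :=
  ∃ l : ∀ ⦃J : E⦄, (J ⟶ I) → {q : D R J × D R J // q.1 * q.2 = 0} → (J ⟶ G),
    (∀ ⦃J K : E⦄ (g : K ⟶ J) (f : J ⟶ I) (a b : D R J) (h : a * b = 0)
      (h' : a.res g * b.res g = 0),
      l (g ≫ f) ⟨(a.res g, b.res g), h'⟩ = g ≫ l f ⟨(a, b), h⟩) ∧
    (∀ ⦃J : E⦄ (f : J ⟶ I) (d : D R J) (h : d * 0 = 0), l f ⟨(d, 0), h⟩ = X.app f d) ∧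
    (∀ ⦃J : E⦄ (f : J ⟶ I) (d : D R J) (h : 0 * d = 0), l f ⟨(0, d), h⟩ = Y.app f d) ∧
    (∀ ⦃J : E⦄ (f : J ⟶ I) (d : D R J) (h : d * d = 0), l f ⟨(d, d), h⟩ = Z.app f d)

/-- `Z` is the Lie bracket of `X` and `Y`: `Z_{ab}` is the commutator `X_a Y_b X_a⁻¹ Y_b⁻¹` for all
`a, b ∈ D`. -/
def IsBracket (X Y Z : Tangent k R G I) : Prop :=
  ∀ ⦃J : E⦄ (f : J ⟶ I) (a b : D R J),
    Z.app f (a * b) = X.app f a * Y.app f b * (X.app f a)⁻¹ * (Y.app f b)⁻¹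

end Tangent

/-! Existence and uniqueness of sums and brackets in a microlinear group, by which the
operations of `𝔤` are defined. -/

/-- The Weil algebra `k[ε]`, whose spectrum is `D`. -/
def dualWeil (k : Type w) [Field k] : WeilAlg k where
  carrier := DualNumber k
  finite := inferInstanceAs (Module.Finite k (k × k))
  augmentation := ⟨TrivSqZeroExt.fstHom k k k, fun x hx =>
    TrivSqZeroExt.isNilpotent_iff_isNilpotent_fst.mpr (by
      rw [show x.fst = 0 from hx]; exact IsNilpotent.zero)⟩

/-- The Weil algebra `k[x, y] / (x ^ 2, x y, y ^ 2)`, whose spectrum is `D(2)`. -/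
def dualWeil₂ (k : Type w) [Field k] : WeilAlg k where
  carrier := TrivSqZeroExt k (k × k)
  finite := inferInstanceAs (Module.Finite k (k × (k × k)))
  augmentation := ⟨TrivSqZeroExt.fstHom k k (k × k), fun x hx =>
    TrivSqZeroExt.isNilpotent_iff_isNilpotent_fst.mpr (by
      rw [show x.fst = 0 from hx]; exact IsNilpotent.zero)⟩

/-- The Weil algebra `k[x, y] / (x ^ 2, y ^ 2)`, whose spectrum is `D × D`. -/
def dualDualWeil (k : Type w) [Field k] : WeilAlg k where
  carrier := DualNumber (DualNumber k)
  finite := inferInstanceAs (Module.Finite k ((k × k) × (k × k)))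
  augmentation := ⟨(TrivSqZeroExt.fstHom k k k).comp
      (TrivSqZeroExt.fstHom k (DualNumber k) (DualNumber k)), fun x hx =>
    TrivSqZeroExt.isNilpotent_iff_isNilpotent_fst.mpr
      (TrivSqZeroExt.isNilpotent_iff_isNilpotent_fst.mpr (by
        rw [show x.fst.fst = 0 from hx]; exact IsNilpotent.zero))⟩

/-- The Weil algebra `k`, whose spectrum is a point. -/
def baseWeil (k : Type w) [Field k] : WeilAlg k where
  carrier := k
  finite := inferInstance
  augmentation := ⟨AlgHom.id k k, fun x hx => by
    rw [show x = 0 from hx]; exact IsNilpotent.zero⟩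

section Points

variable (k : Type w) [Field k] {A : Type*} [CommRing A] [Algebra k A]

/-- The homomorphism `k[ε] → A` with `ε ↦ d`. -/
def dualHom (d : A) (h : d ^ 2 = 0) : DualNumber k →ₐ[k] A :=
  DualNumber.lift ⟨(Algebra.ofId k A, d), by rw [← sq, h], fun _ => Commute.all _ _⟩

@[simp] theorem dualHom_eps (d : A) (h : d ^ 2 = 0) :
    dualHom k d h (DualNumber.eps) = d := DualNumber.lift_apply_eps _

/-- The homomorphism from `k[x, y] / (x ^ 2, y ^ 2)` to `A` with `x ↦ a` and `y ↦ b`. -/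
def dualDualHom (a b : A) (ha : a ^ 2 = 0) (hb : b ^ 2 = 0) :
    DualNumber (DualNumber k) →ₐ[k] A :=
  DualNumber.lift ⟨(dualHom k a ha, b), by rw [← sq, hb], fun _ => Commute.all _ _⟩

@[simp] theorem dualDualHom_inl (a b : A) (ha : a ^ 2 = 0) (hb : b ^ 2 = 0) (x : DualNumber k) :
    dualDualHom k a b ha hb (TrivSqZeroExt.inl x) = dualHom k a ha x :=
  DualNumber.lift_apply_inl _ _

@[simp] theorem dualDualHom_eps (a b : A) (ha : a ^ 2 = 0) (hb : b ^ 2 = 0) :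
    dualDualHom k a b ha hb DualNumber.eps = b := DualNumber.lift_apply_eps _

/-- The homomorphism from `k[x, y] / (x ^ 2, x y, y ^ 2)` to `A` with `x ↦ a` and `y ↦ b`. -/
def dualHom₂ (a b : A) (ha : a ^ 2 = 0) (hb : b ^ 2 = 0) (hab : a * b = 0) :
    TrivSqZeroExt k (k × k) →ₐ[k] A :=
  TrivSqZeroExt.liftEquivOfComm ⟨LinearMap.coprod (LinearMap.toSpanSingleton k A a)
    (LinearMap.toSpanSingleton k A b), fun x y => by
      have hba : b * a = 0 := by rw [mul_comm, hab]
      rw [sq] at ha hb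
      simp [add_mul, mul_add, ha, hb, hab, hba]⟩

@[simp] theorem dualHom₂_inr (a b : A) (ha : a ^ 2 = 0) (hb : b ^ 2 = 0) (hab : a * b = 0)
    (x : k × k) : dualHom₂ k a b ha hb hab (TrivSqZeroExt.inr x) = x.1 • a + x.2 • b := by
  simp [dualHom₂]

theorem dualHom_apply (d : A) (h : d ^ 2 = 0) (x : DualNumber k) :
    dualHom k d h x = algebraMap k A x.fst + algebraMap k A x.snd * d := rfl

theorem dualDualHom_apply (a b : A) (ha : a ^ 2 = 0) (hb : b ^ 2 = 0)
    (x : DualNumber (DualNumber k)) :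
    dualDualHom k a b ha hb x = dualHom k a ha x.fst + dualHom k a ha x.snd * b := rfl

theorem sq_map_eq_zero {B C : Type*} [CommRing B] [CommRing C] (p : B →+* C) {x : B}
    (h : x ^ 2 = 0) : p x ^ 2 = 0 := by rw [← map_pow, h, map_zero]

end Points

namespace Tangent

variable {k : Type w} [Field k] {R : E} [CommRingObj R] [AlgObj k R] {G : E} [GrpObj G]
variable {I J : E}

theorem inl_eps_sq : (TrivSqZeroExt.inl DualNumber.eps : DualNumber (DualNumber k)) ^ 2 = 0 := by
  rw [sq, ← TrivSqZeroExt.inl_mul, DualNumber.eps_mul_eps, TrivSqZeroExt.inl_zero]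

/-- The element of `D` named by an algebra homomorphism and an element of square zero. -/
def point {A : Type*} [CommRing A] [Algebra k A] (p : A →ₐ[k] (J ⟶ R)) (x : A)
    (h : x ^ 2 = 0) : D R J := ⟨p x, sq_map_eq_zero p.toRingHom h⟩

/-- A tangent vector as a generalized element of `G ^ Spec k[ε]`. -/
def toProlong (X : Tangent k R G I) : Prolong k R G (DualNumber k) I where
  app _ f p := X.app f (point p _ DualNumber.eps_pow_two)
  naturality _ _ g f p := X.naturality g f (point p _ DualNumber.eps_pow_two)

/-- A generalized element of `G ^ Spec k[ε]` with value `e` at `0` as a tangent vector. -/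
def ofProlong (s : Prolong k R G (DualNumber k) I)
    (h : ∀ ⦃J : E⦄ (f : J ⟶ I), s.app f (dualHom k (0 : D R J).val (0 : D R J).sq) = 1) :
    Tangent k R G I where
  app _ f d := s.app f (dualHom k d.val d.sq)
  naturality _ _ g f d := by
    rw [← s.naturality]
    congr 1
    apply DualNumber.algHom_ext
    simp
  app_zero _ f := h f

/-- The first coordinate of an element of `D × D`. -/
def ptX (p : DualNumber (DualNumber k) →ₐ[k] (J ⟶ R)) : D R J :=
  ⟨p (TrivSqZeroExt.inl DualNumber.eps), by rw [← map_pow, inl_eps_sq, map_zero]⟩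

/-- The second coordinate of an element of `D × D`. -/
def ptY (p : DualNumber (DualNumber k) →ₐ[k] (J ⟶ R)) : D R J :=
  ⟨p DualNumber.eps, by rw [← map_pow, DualNumber.eps_pow_two, map_zero]⟩

/-- The map `(a, b) ↦ X_a Y_b X_a⁻¹ Y_b⁻¹` on `D × D`. -/
def commProlong (X Y : Tangent k R G I) : Prolong k R G (DualNumber (DualNumber k)) I where
  app _ f p := X.app f (ptX p) * Y.app f (ptY p) * (X.app f (ptX p))⁻¹ * (Y.app f (ptY p))⁻¹
  naturality J K g f p := by
    rw [MonObj.comp_mul, MonObj.comp_mul, MonObj.comp_mul, GrpObj.comp_inv, GrpObj.comp_inv,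
      ← X.naturality, ← Y.naturality]
    rfl

/-- The constant map with value `e`. -/
def oneProlong (W : Type w) [CommRing W] [Algebra k W] : Prolong k R G W I where
  app _ _ _ := 1
  naturality _ _ g _ _ := (MonObj.comp_one g).symm

theorem inr_eps_sq : (TrivSqZeroExt.inr DualNumber.eps : DualNumber (DualNumber k)) ^ 2 = 0 := by
  rw [sq, TrivSqZeroExt.inr_mul_inr]

theorem zero_dual_sq : (0 : DualNumber k) ^ 2 = 0 := by simp

theorem app_eq_one (X : Tangent k R G I) (f : J ⟶ I) (d : D R J) (h : d.val = 0) :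
    X.app f d = 1 := by
  rw [show d = 0 from D.ext h, X.app_zero]

theorem commProlong_eq_one (X Y : Tangent k R G I) (f : J ⟶ I)
    (p : DualNumber (DualNumber k) →ₐ[k] (J ⟶ R))
    (h : p (TrivSqZeroExt.inl DualNumber.eps) = 0 ∨ p DualNumber.eps = 0) :
    (commProlong X Y).app f p = 1 := by
  change X.app f (ptX p) * Y.app f (ptY p) * (X.app f (ptX p))⁻¹ * (Y.app f (ptY p))⁻¹ = 1
  rcases h with h | h
  · rw [app_eq_one X f (ptX p) h]
    group
  · rw [app_eq_one Y f (ptY p) h]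
    group

/-- The homomorphism `k[ε] → k[x, y] / (x ^ 2, y ^ 2)` with `ε ↦ x y`. -/
def mulHom (k : Type w) [Field k] : DualNumber k →ₐ[k] DualNumber (DualNumber k) :=
  dualHom k (A := DualNumber (DualNumber k)) _ inr_eps_sq

theorem fst_mulHom (x : DualNumber k) : (mulHom k x).fst = TrivSqZeroExt.inl x.fst := by
  change TrivSqZeroExt.fst (algebraMap k (DualNumber (DualNumber k)) x.fst +
    algebraMap k (DualNumber (DualNumber k)) x.snd * TrivSqZeroExt.inr DualNumber.eps) = _
  simp [TrivSqZeroExt.algebraMap_eq_inl']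

theorem snd_mulHom (x : DualNumber k) : (mulHom k x).snd = TrivSqZeroExt.inr x.snd := by
  change TrivSqZeroExt.snd (algebraMap k (DualNumber (DualNumber k)) x.fst +
    algebraMap k (DualNumber (DualNumber k)) x.snd * TrivSqZeroExt.inr DualNumber.eps) = _
  ext <;> simp [TrivSqZeroExt.algebraMap_eq_inl']

variable [Microlinear k R G]

theorem existsUnique_prolong_bracket (X Y : Tangent k R G I) :
    ∃! s : Prolong k R G (DualNumber k) I,
      s.map (mulHom k) = commProlong X Y ∧
      s.map (dualHom k _ zero_dual_sq) = oneProlong (DualNumber k) := by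
  have e2 : (DualNumber.eps : DualNumber k) ^ 2 = 0 := DualNumber.eps_pow_two
  have z2 : (0 : DualNumber k) ^ 2 = 0 := by simp
  let A : Bool → WeilAlg k := fun b => bif b then dualDualWeil k else dualWeil k
  let F : ∀ _ : Fin 3, DualNumber (DualNumber k) →ₐ[k] DualNumber k :=
    ![dualDualHom k DualNumber.eps 0 e2 z2, dualDualHom k 0 DualNumber.eps z2 e2,
      dualDualHom k 0 0 z2 z2]
  let πt : DualNumber k →ₐ[k] DualNumber (DualNumber k) := mulHom k
  let πf : DualNumber k →ₐ[k] DualNumber k := dualHom k _ zero_dual_sq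
  let π : ∀ a, dualWeil k →ₐ[k] A a := fun a => match a with
    | true => πt
    | false => πf
  let t : ∀ a, Prolong k R G (A a) I := fun a => match a with
    | true => commProlong X Y
    | false => oneProlong (DualNumber k)
  have key := Microlinear.isLimit (k := k) (R := R) (M := G) Bool (Fin 3) (fun _ => true)
    (fun _ => false) A F (dualWeil k) π ?_ ?_ I t ?_
  · obtain ⟨s, hs, hu⟩ := key
    refine ⟨s, ⟨hs true, hs false⟩, fun s' h => hu s' fun a => ?_⟩
    cases a
    · exact h.2
    · exact h.1
  · intro q
    refine DualNumber.algHom_ext ?_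
    change F q (mulHom k DualNumber.eps) = dualHom k (0 : DualNumber k) _ DualNumber.eps
    rw [dualHom_eps]
    fin_cases q <;> simp [F, dualDualHom_apply, fst_mulHom, snd_mulHom]
  · intro y hy
    have hF : ∀ q, F q (y true) = (y false : DualNumber k) := hy
    obtain ⟨v, hv⟩ : ∃ v : DualNumber (DualNumber k), v = y true := ⟨_, rfl⟩
    obtain ⟨x, hx⟩ : ∃ x : DualNumber k, x = y false := ⟨_, rfl⟩
    rw [← hv, ← hx] at hF
    have h0 := hF 0
    have h1 := hF 1
    have h2 := hF 2
    simp only [F, Matrix.cons_val_zero, Matrix.cons_val_one, Matrix.cons_val, dualDualHom_apply,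
      dualHom_apply, TrivSqZeroExt.algebraMap_eq_inl, mul_zero, add_zero] at h0 h1 h2
    have h0' := congrArg TrivSqZeroExt.snd (h0.trans h2.symm)
    have h1' := congrArg TrivSqZeroExt.snd (h1.trans h2.symm)
    simp at h0' h1'
    refine ⟨(TrivSqZeroExt.inl v.fst.fst + TrivSqZeroExt.inr v.snd.snd : DualNumber k), ?_, ?_⟩
    · intro a
      cases a
      · change dualHom k (0 : DualNumber k) _ _ = y false
        rw [← hx, ← h2]
        simp [dualHom_apply, TrivSqZeroExt.algebraMap_eq_inl]
      · change mulHom k _ = y true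
        rw [← hv]
        ext <;> simp [fst_mulHom, snd_mulHom, h0', h1']
    · intro z hz
      have hz' : mulHom k z = v := (hz true).trans hv.symm
      have gen : ∀ z : DualNumber k, z = TrivSqZeroExt.inl (mulHom k z).fst.fst +
          TrivSqZeroExt.inr (mulHom k z).snd.snd := fun z => by
        ext <;> simp [fst_mulHom, snd_mulHom]
      rw [← hz']
      exact gen z
  · intro q
    ext J f p
    refine commProlong_eq_one X Y f (p.comp (F q)) ?_
    have gen : ∀ p : DualNumber k →ₐ[k] (J ⟶ R),
        p (F q (TrivSqZeroExt.inl DualNumber.eps)) = 0 ∨ p (F q DualNumber.eps) = 0 := by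
      intro p
      fin_cases q <;> simp [F]
    exact gen p

theorem existsUnique_isBracket (X Y : Tangent k R G I) : ∃! Z, IsBracket X Y Z := by
  obtain ⟨s, ⟨hs, hs0⟩, hu⟩ := existsUnique_prolong_bracket X Y
  have happ : ∀ ⦃J : E⦄ (f : J ⟶ I) (p q : DualNumber k →ₐ[k] (J ⟶ R)),
      p DualNumber.eps = q DualNumber.eps → s.app f p = s.app f q := fun J f p q h => by
    rw [DualNumber.algHom_ext h]
  refine ⟨ofProlong s fun J f => ?_, fun J f a b => ?_, fun Z hZ => ?_⟩
  · refine Eq.trans ?_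
      (congrArg (fun u => u.app f (dualHom k (0 : D R J).val (0 : D R J).sq)) hs0)
    refine happ f _ ((dualHom k (0 : D R J).val (0 : D R J).sq).comp
      (dualHom k (0 : DualNumber k) zero_dual_sq)) ?_
    simp
  · have h := congrArg (fun u => u.app f (dualDualHom k a.val b.val a.sq b.sq)) hs
    have ha : ptX (dualDualHom k a.val b.val a.sq b.sq) = a :=
      D.ext ((dualDualHom_inl k a.val b.val a.sq b.sq _).trans (dualHom_eps k a.val a.sq))
    have hb : ptY (dualDualHom k a.val b.val a.sq b.sq) = b :=
      D.ext (dualDualHom_eps k a.val b.val a.sq b.sq)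
    change _ = X.app f (ptX _) * Y.app f (ptY _) * (X.app f (ptX _))⁻¹ * (Y.app f (ptY _))⁻¹ at h
    rw [ha, hb] at h
    refine Eq.trans ?_ h
    refine happ f _ ((dualDualHom k a.val b.val a.sq b.sq).comp (mulHom k)) ?_
    simp [dualDualHom_apply, fst_mulHom, snd_mulHom, dualHom_apply]
  · have : Z.toProlong = s := by
      refine hu _ ⟨?_, ?_⟩
      · ext J f p
        refine Eq.trans ?_ (hZ f (ptX p) (ptY p))
        refine congrArg (Z.app f) (D.ext ?_)
        have gen : mulHom k DualNumber.eps =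
            TrivSqZeroExt.inl DualNumber.eps * (DualNumber.eps : DualNumber (DualNumber k)) := by
          ext <;> simp [fst_mulHom, snd_mulHom]
        exact (congrArg p gen).trans (map_mul p _ _)
      · ext J f p
        refine app_eq_one Z f _ ?_
        exact (congrArg p (dualHom_eps k (0 : DualNumber k) zero_dual_sq)).trans (map_zero p)
    subst this
    ext J f d
    refine congrArg (Z.app f) (D.ext ?_)
    exact (dualHom_eps k d.val d.sq).symm

theorem existsUnique_prolong_sum (X Y : Tangent k R G I) :
    ∃! s : Prolong k R G (TrivSqZeroExt k (k × k)) I,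
      s.map (TrivSqZeroExt.map (LinearMap.fst k k k)) = X.toProlong ∧
      s.map (TrivSqZeroExt.map (LinearMap.snd k k k)) = Y.toProlong := by
  have hfst : ∀ (g : k × k →ₗ[k] k) (x : TrivSqZeroExt k (k × k)),
      TrivSqZeroExt.fst (TrivSqZeroExt.map g x) = TrivSqZeroExt.fst x :=
    fun g x => TrivSqZeroExt.fst_map g x
  let A : Option Bool → WeilAlg k := fun a => match a with
    | some _ => dualWeil k
    | none => baseWeil k
  let π : ∀ a, dualWeil₂ k →ₐ[k] A a := fun a => match a with
    | some true => TrivSqZeroExt.map (LinearMap.fst k k k)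
    | some false => TrivSqZeroExt.map (LinearMap.snd k k k)
    | none => TrivSqZeroExt.fstHom k k (k × k)
  let t : ∀ a, Prolong k R G (A a) I := fun a => match a with
    | some true => X.toProlong
    | some false => Y.toProlong
    | none => oneProlong k
  have key := Microlinear.isLimit (k := k) (R := R) (M := G) (Option Bool) Bool some
    (fun _ => none) A (fun _ => TrivSqZeroExt.fstHom k k k) (dualWeil₂ k) π ?_ ?_ I t ?_
  · obtain ⟨s, hs, hu⟩ := key
    refine ⟨s, ⟨hs (some true), hs (some false)⟩, fun s' h => hu s' fun a => ?_⟩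
    match a with
    | some true => exact h.1
    | some false => exact h.2
    | none =>
      ext J f p
      have h1 := congrArg (fun u => u.app f (p.comp (TrivSqZeroExt.fstHom k k k))) h.1
      refine Eq.trans ?_ (h1.trans (app_eq_one X f _ ?_))
      · change s'.app f _ = s'.app f _
        congr 1
        refine AlgHom.ext fun x => ?_
        exact congrArg p (hfst (LinearMap.fst k k k) x).symm
      · change p (TrivSqZeroExt.fst DualNumber.eps) = 0
        rw [DualNumber.fst_eps, map_zero]
  · intro q
    cases q
    all_goals
      apply AlgHom.ext
      intro x
      exact hfst _ x
  · intro y hy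
    have hF : ∀ b : Bool, TrivSqZeroExt.fst (y (some b) : DualNumber k) = y none := hy
    obtain ⟨v, hv⟩ : ∃ v : DualNumber k, v = y (some true) := ⟨_, rfl⟩
    obtain ⟨v', hv'⟩ : ∃ v : DualNumber k, v = y (some false) := ⟨_, rfl⟩
    obtain ⟨c, hc⟩ : ∃ c : k, c = y none := ⟨_, rfl⟩
    have h1 : v.fst = c := by rw [hv, hc]; exact hF true
    have h2 : v'.fst = c := by rw [hv', hc]; exact hF false
    refine ⟨(TrivSqZeroExt.inl v.fst + TrivSqZeroExt.inr (v.snd, v'.snd) :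
      TrivSqZeroExt k (k × k)), ?_, ?_⟩
    · intro a
      match a with
      | some true =>
        refine Eq.trans ?_ hv
        change TrivSqZeroExt.map (LinearMap.fst k k k) _ = v
        ext <;> simp
      | some false =>
        refine Eq.trans ?_ hv'
        change TrivSqZeroExt.map (LinearMap.snd k k k) _ = v'
        ext <;> simp [h1, h2]
      | none =>
        refine Eq.trans ?_ (h1.trans hc)
        change TrivSqZeroExt.fst (_ : TrivSqZeroExt k (k × k)) = v.fst
        simp
    · intro z hz
      have h1 : TrivSqZeroExt.map (LinearMap.fst k k k) z = v := (hz (some true)).trans hv.symm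
      have h2 : TrivSqZeroExt.map (LinearMap.snd k k k) z = v' :=
        (hz (some false)).trans hv'.symm
      have gen : ∀ z : TrivSqZeroExt k (k × k), z = TrivSqZeroExt.inl
          (TrivSqZeroExt.map (LinearMap.fst k k k) z).fst + TrivSqZeroExt.inr
            ((TrivSqZeroExt.map (LinearMap.fst k k k) z).snd,
              (TrivSqZeroExt.map (LinearMap.snd k k k) z).snd) := fun z => by
        ext <;> simp
      rw [← h1, ← h2]
      exact gen z
  · intro q
    have gen : ∀ (Z : Tangent k R G I),
        Z.toProlong.map (TrivSqZeroExt.fstHom k k k) = oneProlong k := by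
      intro Z
      ext J f p
      refine app_eq_one Z f _ ?_
      change p (TrivSqZeroExt.fst DualNumber.eps) = 0
      rw [DualNumber.fst_eps, map_zero]
    cases q
    · exact gen Y
    · exact gen X

theorem inr_pair_sq (x : k × k) : (TrivSqZeroExt.inr x : TrivSqZeroExt k (k × k)) ^ 2 = 0 := by
  rw [sq, TrivSqZeroExt.inr_mul_inr]

theorem _root_.SDG.D.mul_self (d : D R J) : d * d = 0 := D.ext ((sq d.val).symm.trans d.sq)

theorem existsUnique_isSum (X Y : Tangent k R G I) : ∃! Z, IsSum X Y Z := by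
  obtain ⟨s, ⟨hX, hY⟩, hu⟩ := existsUnique_prolong_sum X Y
  have happ : ∀ ⦃J : E⦄ (f : J ⟶ I) (p q : TrivSqZeroExt k (k × k) →ₐ[k] (J ⟶ R)),
      p (TrivSqZeroExt.inr (1, 0)) = q (TrivSqZeroExt.inr (1, 0)) →
      p (TrivSqZeroExt.inr (0, 1)) = q (TrivSqZeroExt.inr (0, 1)) →
      s.app f p = s.app f q := fun J f p q h h' => by
    congr 1
    apply TrivSqZeroExt.algHom_ext
    rintro ⟨x, y⟩
    have : ((x, y) : k × k) = x • (1, 0) + y • (0, 1) := by simp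
    rw [this, TrivSqZeroExt.inr_add, TrivSqZeroExt.inr_smul, TrivSqZeroExt.inr_smul]
    simp only [map_add, map_smul, h, h']
  have hX' : ∀ ⦃J : E⦄ (f : J ⟶ I) (d : D R J) (p : TrivSqZeroExt k (k × k) →ₐ[k] (J ⟶ R)),
      p (TrivSqZeroExt.inr (1, 0)) = d.val → p (TrivSqZeroExt.inr (0, 1)) = 0 →
      s.app f p = X.app f d := fun J f d p h h' => by
    have h1 := congrArg (fun u => u.app f (dualHom k d.val d.sq)) hX
    refine Eq.trans ?_ (h1.trans ?_)
    · refine happ f _ _ ?_ ?_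
      · simp [h]
      · simp [h']
    · exact congrArg (X.app f) (D.ext (dualHom_eps k d.val d.sq))
  have hY' : ∀ ⦃J : E⦄ (f : J ⟶ I) (d : D R J) (p : TrivSqZeroExt k (k × k) →ₐ[k] (J ⟶ R)),
      p (TrivSqZeroExt.inr (1, 0)) = 0 → p (TrivSqZeroExt.inr (0, 1)) = d.val →
      s.app f p = Y.app f d := fun J f d p h h' => by
    have h1 := congrArg (fun u => u.app f (dualHom k d.val d.sq)) hY
    refine Eq.trans ?_ (h1.trans ?_)
    · refine happ f _ _ ?_ ?_
      · simp [h]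
      · simp [h']
    · exact congrArg (Y.app f) (D.ext (dualHom_eps k d.val d.sq))
  have hval : ∀ {J : E} {a b : D R J}, a * b = 0 → a.val * b.val = 0 :=
    fun h => congrArg D.val h
  let Z : Tangent k R G I :=
    { app := fun J f d => s.app f (dualHom₂ k d.val d.val d.sq d.sq (hval d.mul_self))
      naturality := fun J K g f d => by
        rw [← s.naturality]
        refine happ _ _ _ ?_ ?_ <;> simp
      app_zero := fun J f => by
        rw [hX' f 0 _ (by simp) (by simp), X.app_zero] }
  refine ⟨Z, ⟨fun J f q => s.app f (dualHom₂ k q.1.1.val q.1.2.val q.1.1.sq q.1.2.sq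
    (hval q.2)), ?_, ?_, ?_, ?_⟩, ?_⟩
  · intro J K g f a b h h'
    rw [← s.naturality]
    refine happ _ _ _ ?_ ?_ <;> simp
  · intro J f d h
    exact hX' f d _ (by simp) (by simp)
  · intro J f d h
    exact hY' f d _ (by simp) (by simp)
  · intro J f d h
    rfl
  · rintro Z' ⟨l, hn, hl1, hl2, hl3⟩
    let s' : Prolong k R G (TrivSqZeroExt k (k × k)) I :=
      { app := fun J f p => l f ⟨(point p _ (inr_pair_sq (1, 0)), point p _ (inr_pair_sq (0, 1))),
          D.ext (by
            change p _ * p _ = 0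
            rw [← map_mul, TrivSqZeroExt.inr_mul_inr, map_zero])⟩
        naturality := fun J K g f p => hn g f (point p _ (inr_pair_sq (1, 0)))
          (point p _ (inr_pair_sq (0, 1))) _ _ }
    have hl : ∀ ⦃J : E⦄ (f : J ⟶ I) (q q' : {q : D R J × D R J // q.1 * q.2 = 0}),
        q.1.1.val = q'.1.1.val → q.1.2.val = q'.1.2.val → l f q = l f q' :=
      fun J f q q' h h' => congrArg (l f) (Subtype.ext (Prod.ext (D.ext h) (D.ext h')))
    have hs' : s' = s := by
      refine hu s' ⟨?_, ?_⟩
      · ext J f p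
        refine Eq.trans (hl f _ ⟨(point p _ DualNumber.eps_pow_two, 0), ?_⟩ ?_ ?_)
          (hl1 f (point p _ DualNumber.eps_pow_two) ?_)
        · exact D.ext (mul_zero _)
        · exact congrArg p (by ext <;> simp)
        · exact (congrArg p (by ext <;> simp)).trans (map_zero p)
        · exact D.ext (mul_zero _)
      · ext J f p
        refine Eq.trans (hl f _ ⟨(0, point p _ DualNumber.eps_pow_two), ?_⟩ ?_ ?_)
          (hl2 f (point p _ DualNumber.eps_pow_two) ?_)
        · exact D.ext (zero_mul _)
        · exact (congrArg p (by ext <;> simp)).trans (map_zero p)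
        · exact congrArg p (by ext <;> simp)
        · exact D.ext (zero_mul _)
    ext J f d
    rw [← hl3 f d d.mul_self]
    change _ = s.app f _
    rw [← hs']
    refine hl f _ _ ?_ ?_
    · change d.val = dualHom₂ k d.val d.val _ _ _ _
      simp
    · change d.val = dualHom₂ k d.val d.val _ _ _ _
      simp

/-- Addition on `𝔤`. -/
noncomputable instance : Add (Tangent k R G I) :=
  ⟨fun X Y => (existsUnique_isSum X Y).exists.choose⟩

/-- The Lie bracket of `𝔤`. -/
noncomputable instance : Bracket (Tangent k R G I) (Tangent k R G I) :=
  ⟨fun X Y => (existsUnique_isBracket X Y).exists.choose⟩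

/-- `X - Y = X + (-1) Y`. -/
noncomputable instance : Sub (Tangent k R G I) := ⟨fun X Y => X + (-1 : I ⟶ R) • Y⟩

end Tangent

/-- An exponential mapping of `G`: a natural map `exp : 𝔤 → G` such that for every `X` in `𝔤` the
map `t ↦ exp (t X)` is a one-parameter subgroup of `G` whose tangent vector at `0` is `X`. -/
structure ExpMap (k : Type w) [Field k] (R : E) [CommRingObj R] [AlgObj k R] (G : E)
    [GrpObj G] where
  app : ∀ ⦃I : E⦄, Tangent k R G I → (I ⟶ G)
  naturality : ∀ ⦃I J : E⦄ (g : J ⟶ I) (X : Tangent k R G I), app (X.res g) = g ≫ app X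
  add_smul : ∀ ⦃I : E⦄ (X : Tangent k R G I) (s t : I ⟶ R),
    app ((s + t) • X) = app (s • X) * app (t • X)
  tangent : ∀ ⦃I : E⦄ (X : Tangent k R G I) (d : D R I), app (d.val • X) = X.app (𝟙 I) d

end LieAlgebra

end SDG

/-! On a sum of elements of `D`, an exponential is a finite product: exp((d₁+…+d₄)X) = X_{d₁}⋯X_{d₄}
(`ExpMap.app_sum_smul`). The exponent on the right of the theorem is sV(s), with V(s) polynomial in
s (`bchVec`), so the claim becomes ∏X_{dᵢ} · ∏Y_{dᵢ} = ∏V(s)_{dᵢ}, an identity between values of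
tangent vectors.

It is proved by adding one dᵢ at a time, an infinitesimal form of solving a differential equation in
s. On the left the new X_{d₄} is moved past the Y_{dᵢ}, which turns X into e^{-s ad Y}X. On the
right V(s+d₄) = V + d₄V', and the increments are moved past the V_{dᵢ}, which produces sV' - s²/2
[V,V'] + s³/6 [V,[V,V']]. Both sides then agree once e^{-s ad Y}X + Y = V + sV' - s²/2 [V,V'] + s³/6
[V,[V,V']] modulo s⁴, which is `bchVec_ode`, pure Lie algebra.

The rules for moving factors come from microlinearity: (X+Y)_d = X_d Y_d (`app_add`), and
conjugation by X_a sends Y to Y + a[X,Y] (`conj_app`). They also make 𝔤 a Lie algebra; the Jacobi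
identity expresses that conjugation preserves commutators. -/

namespace SDG

/-! ### Calculus of values X_d: sums, commutators, additivity in d. -/

namespace Tangent

variable {E : Type u} [Category.{v} E] [CartesianMonoidalCategory E] [BraidedCategory E]
variable {k : Type w} [Field k] {R : E} [CommRingObj R] [AlgObj k R] {G : E} [GrpObj G]
variable {I J : E}

theorem app_congr (X : Tangent k R G I) (f : J ⟶ I) {a b : D R J} (h : a.val = b.val) :
    X.app f a = X.app f b := congrArg (X.app f) (D.ext h)

theorem app_smul (r : I ⟶ R) (X : Tangent k R G I) (f : J ⟶ I) (d : D R J) :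
    (r • X).app f d = X.app f ((f ≫ r) • d) := rfl

theorem res_app (g : J ⟶ I) (X : Tangent k R G I) {K : E} (f : K ⟶ J) (d : D R K) :
    (X.res g).app f d = X.app (f ≫ g) d := rfl

/-- The pointwise product of two tangent vectors at the unit. -/
def pointwiseMul (X Y : Tangent k R G I) : Tangent k R G I where
  app _ f d := X.app f d * Y.app f d
  naturality _ _ g f d := by rw [MonObj.comp_mul, X.naturality, Y.naturality]
  app_zero _ f := by rw [X.app_zero, Y.app_zero, mul_one]

/-- The witness is (a, b) ↦ X_a Y_b. With uniqueness of sums this gives `app_add`, which turns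
addition in 𝔤 into multiplication in G. -/
theorem isSum_pointwiseMul (X Y : Tangent k R G I) : IsSum X Y (pointwiseMul X Y) :=
  ⟨fun _ f q => X.app f q.1.1 * Y.app f q.1.2,
    fun _ _ g f a b _ _ => by
      change X.app (g ≫ f) (a.res g) * Y.app (g ≫ f) (b.res g) = g ≫ (X.app f a * Y.app f b)
      rw [MonObj.comp_mul, X.naturality, Y.naturality],
    fun _ f d _ => by change X.app f d * Y.app f 0 = _; rw [Y.app_zero, mul_one],
    fun _ f d _ => by change X.app f 0 * Y.app f d = _; rw [X.app_zero, one_mul],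
    fun _ _ _ _ => rfl⟩

/-- Both sides are X_{ab}. This lets an increment of the vector be read as a value at the increment
of s. -/
theorem smul_app_comm (X : Tangent k R G I) (a b : D R I) :
    (a.val • X).app (𝟙 I) b = (b.val • X).app (𝟙 I) a := by
  refine app_congr X _ ?_
  simp only [D.val_smul, Category.id_comp, mul_comm]

theorem smul_app_self (X : Tangent k R G I) (a : D R I) : (a.val • X).app (𝟙 I) a = 1 := by
  refine app_eq_one X _ _ ?_
  rw [D.val_smul, Category.id_comp, ← _root_.sq, a.sq]

instance : Zero (Tangent k R G I) :=
  ⟨{ app := fun _ _ _ => 1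
     naturality := fun _ _ g _ _ => (MonObj.comp_one g).symm
     app_zero := fun _ _ => rfl }⟩

theorem app_zero_vec (f : J ⟶ I) (d : D R J) : (0 : Tangent k R G I).app f d = 1 := rfl

variable [Microlinear k R G]

theorem isSum_add (X Y : Tangent k R G I) : IsSum X Y (X + Y) :=
  (existsUnique_isSum X Y).exists.choose_spec

theorem isBracket_lie (X Y : Tangent k R G I) : IsBracket X Y ⁅X, Y⁆ :=
  (existsUnique_isBracket X Y).exists.choose_spec

theorem app_add (X Y : Tangent k R G I) (f : J ⟶ I) (d : D R J) :
    (X + Y).app f d = X.app f d * Y.app f d := by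
  rw [(existsUnique_isSum X Y).unique (isSum_add X Y) (isSum_pointwiseMul X Y)]
  rfl

theorem app_lie (X Y : Tangent k R G I) (f : J ⟶ I) (a b : D R J) :
    ⁅X, Y⁆.app f (a * b) = X.app f a * Y.app f b * (X.app f a)⁻¹ * (Y.app f b)⁻¹ :=
  isBracket_lie X Y f a b

/-- The commutator is [X,Y]_{ab} = [X,Y]_0 = e. -/
theorem app_commute (X Y : Tangent k R G I) (f : J ⟶ I) {a b : D R J} (h : a.val * b.val = 0) :
    Commute (X.app f a) (Y.app f b) := by
  have h1 := app_lie X Y f a b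
  rw [app_eq_one _ f (a * b) h, eq_comm, mul_inv_eq_one, mul_inv_eq_iff_eq_mul] at h1
  exact h1

theorem app_mul_app (X Y : Tangent k R G I) (f : J ⟶ I) (a b : D R J) :
    X.app f a * Y.app f b = ⁅X, Y⁆.app f (a * b) * (Y.app f b * X.app f a) := by
  rw [app_lie]; group

/-- A map on `D(2)` with values in a microlinear object is determined by its restrictions to the
axes; here this is applied to `(a, b) ↦ X_{a + b}`. -/
theorem app_add_point (X : Tangent k R G I) (f : J ⟶ I) (a b c : D R J)
    (h : a.val * b.val = 0) (hc : c.val = a.val + b.val) :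
    X.app f c = X.app f a * X.app f b := by
  -- X_{a+b} and X_a X_b both restrict to X on each axis, so uniqueness for the pair (X, X)
  -- identifies them.
  obtain ⟨s, -, hu⟩ := existsUnique_prolong_sum X X
  let s₁ : Prolong k R G (TrivSqZeroExt k (k × k)) I :=
    { app := fun J f p => X.app f (point p _ (inr_pair_sq (1, 1)))
      naturality := fun J K g f p => X.naturality g f (point p _ (inr_pair_sq (1, 1))) }
  let s₂ : Prolong k R G (TrivSqZeroExt k (k × k)) I :=
    { app := fun J f p => X.app f (point p _ (inr_pair_sq (1, 0))) *
        X.app f (point p _ (inr_pair_sq (0, 1)))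
      naturality := fun J K g f p => by
        rw [MonObj.comp_mul, ← X.naturality, ← X.naturality]; rfl }
  have e₁ : s₁ = s := by
    refine hu s₁ ⟨?_, ?_⟩
    · ext J f p
      exact app_congr X f (congrArg p (by ext <;> simp))
    · ext J f p
      exact app_congr X f (congrArg p (by ext <;> simp))
  have e₂ : s₂ = s := by
    refine hu s₂ ⟨?_, ?_⟩
    · ext J f p
      refine Eq.trans (congrArg₂ (· * ·) (app_congr X f (congrArg p ?_))
        (app_eq_one X f _ ?_)) (mul_one _)
      · ext <;> simp
      · exact (congrArg p (by ext <;> simp)).trans (map_zero p)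
    · ext J f p
      refine Eq.trans (congrArg₂ (· * ·) (app_eq_one X f _ ?_)
        (app_congr X f (congrArg p ?_))) (one_mul _)
      · exact (congrArg p (by ext <;> simp)).trans (map_zero p)
      · ext <;> simp
  have h12 := congrArg (fun u => u.app f (dualHom₂ k a.val b.val a.sq b.sq h)) (e₁.trans e₂.symm)
  refine Eq.trans (app_congr X f ?_) (h12.trans (congrArg₂ (· * ·)
    (app_congr X f ?_) (app_congr X f ?_)))
  · change c.val = dualHom₂ k a.val b.val a.sq b.sq h _
    simp [hc]
  · change dualHom₂ k a.val b.val a.sq b.sq h _ = _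
    simp
  · change dualHom₂ k a.val b.val a.sq b.sq h _ = _
    simp

theorem app_neg_point (X : Tangent k R G I) (f : J ⟶ I) (d : D R J) :
    X.app f (-d) = (X.app f d)⁻¹ := by
  rw [eq_inv_iff_mul_eq_one, ← app_add_point X f (-d) d 0, X.app_zero]
  · rw [D.val_neg, neg_mul, ← _root_.sq, d.sq, neg_zero]
  · simp

/-! ### The module structure of 𝔤 over the line. -/

instance : Neg (Tangent k R G I) := ⟨fun X => (-1 : I ⟶ R) • X⟩

theorem app_neg (X : Tangent k R G I) (f : J ⟶ I) (d : D R J) :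
    (-X).app f d = (X.app f d)⁻¹ := by
  rw [← app_neg_point]
  refine app_congr X f ?_
  change (f ≫ (-1 : I ⟶ R)) * d.val = -d.val
  rw [← restrict_apply R k f, map_neg, map_one, neg_one_mul]

noncomputable instance : AddCommGroup (Tangent k R G I) where
  add_assoc X Y Z := by ext J f d; simp only [app_add, mul_assoc]
  zero_add X := by ext J f d; rw [app_add, app_zero_vec, one_mul]
  add_zero X := by ext J f d; rw [app_add, app_zero_vec, mul_one]
  add_comm X Y := by
    ext J f d
    rw [app_add, app_add]
    exact app_commute X Y f ((_root_.sq _).symm.trans d.sq)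
  neg_add_cancel X := by ext J f d; rw [app_add, app_neg, inv_mul_cancel]; rfl
  sub_eq_add_neg _ _ := rfl
  nsmul := nsmulRec
  zsmul := zsmulRec

noncomputable instance : Module (I ⟶ R) (Tangent k R G I) where
  one_smul X := by
    ext J f d
    refine app_congr X f ?_
    rw [D.val_smul, ← restrict_apply R k f, map_one, one_mul]
  mul_smul r s X := by
    ext J f d
    refine app_congr X f ?_
    simp only [D.val_smul, ← restrict_apply R k f, map_mul]
    ring
  smul_zero r := rfl
  smul_add r X Y := by ext J f d; simp only [app_add, app_smul]
  add_smul r s X := by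
    ext J f d
    rw [app_add, app_smul, app_smul, app_smul]
    refine app_add_point X f _ _ _ ?_ ?_
    · simp only [D.val_smul]
      linear_combination (f ≫ r) * (f ≫ s) * d.sq
    · simp only [D.val_smul, ← restrict_apply R k f, map_add, add_mul]
  zero_smul X := by
    ext J f d
    refine app_eq_one X f _ ?_
    rw [D.val_smul, ← restrict_apply R k f, map_zero, zero_mul]

/-! ### The Lie algebra structure of 𝔤 and the adjoint action. -/

theorem lie_eq_of_isBracket {X Y Z : Tangent k R G I} (h : IsBracket X Y Z) : ⁅X, Y⁆ = Z :=
  (existsUnique_isBracket X Y).unique (isBracket_lie X Y) h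

/-- A tangent vector is determined by its values on products of elements of `D`. -/
theorem ext_mul {X Y : Tangent k R G I}
    (h : ∀ ⦃J : E⦄ (f : J ⟶ I) (a b : D R J), X.app f (a * b) = Y.app f (a * b)) : X = Y := by
  -- X - Y vanishes on all products ab, so it qualifies as a bracket of 0 and 0, and so does 0;
  -- brackets are unique.
  have h0 : IsBracket (0 : Tangent k R G I) 0 (X - Y) := fun J f a b => by
    rw [sub_eq_add_neg, app_add, app_neg, h]
    simp [app_zero_vec]
  have h1 : IsBracket (0 : Tangent k R G I) 0 0 := fun J f a b => by
    simp [app_zero_vec]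
  exact sub_eq_zero.mp ((existsUnique_isBracket _ _).unique h0 h1)

theorem lie_skew_aux (X Y : Tangent k R G I) : ⁅X, Y⁆ = -⁅Y, X⁆ := by
  refine ext_mul fun J f a b => ?_
  rw [app_neg, app_lie, app_congr (a := a * b) (b := b * a) ⁅Y, X⁆ f (mul_comm a.val b.val),
    app_lie]
  group

theorem lie_add_aux (X Y Z : Tangent k R G I) : ⁅X, Y + Z⁆ = ⁅X, Y⁆ + ⁅X, Z⁆ := by
  refine lie_eq_of_isBracket fun J f a b => ?_
  -- The parameters b and ab have product ab² = 0.
  have hc : Commute (Y.app f b) (⁅X, Z⁆.app f (a * b)) := by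
    refine app_commute Y _ f ?_
    rw [D.val_mul]
    linear_combination a.val * b.sq
  rw [app_add, app_add, eq_mul_inv_iff_mul_eq, eq_mul_inv_iff_mul_eq, ← mul_assoc (X.app f a),
    app_mul_app X Y, mul_assoc _ _ (Z.app f b), mul_assoc (Y.app f b), app_mul_app X Z]
  calc _ = ⁅X, Y⁆.app f (a * b) * (⁅X, Z⁆.app f (a * b) * Y.app f b) * Z.app f b * X.app f a := by
        group
    _ = _ := by rw [← hc.eq]; group

theorem lie_smul_aux (r : I ⟶ R) (X Y : Tangent k R G I) : ⁅X, r • Y⁆ = r • ⁅X, Y⁆ := by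
  refine lie_eq_of_isBracket fun J f a b => ?_
  rw [app_smul, app_smul, ← app_lie]
  refine app_congr _ f ?_
  simp only [D.val_smul, D.val_mul]
  ring

theorem add_lie_aux (X Y Z : Tangent k R G I) : ⁅X + Y, Z⁆ = ⁅X, Z⁆ + ⁅Y, Z⁆ := by
  rw [lie_skew_aux, lie_add_aux, lie_skew_aux X Z, lie_skew_aux Y Z, neg_add]

theorem smul_lie_aux (r : I ⟶ R) (X Y : Tangent k R G I) : ⁅r • X, Y⁆ = r • ⁅X, Y⁆ := by
  rw [lie_skew_aux, lie_smul_aux, lie_skew_aux X Y, smul_neg]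

theorem res_lie (g : J ⟶ I) (X Y : Tangent k R G I) : ⁅X, Y⁆.res g = ⁅X.res g, Y.res g⁆ :=
  (lie_eq_of_isBracket fun _ f a b => app_lie X Y (f ≫ g) a b).symm

/-- The adjoint action of `X_a`: conjugation by `X_a` carries `Y` to `Y + a [X, Y]`. -/
theorem conj_app (X Y : Tangent k R G I) (a : D R I) (f : J ⟶ I) (d : D R J) :
    X.app f (a.res f) * Y.app f d * (X.app f (a.res f))⁻¹ =
      (Y + a.val • ⁅X, Y⁆).app f d := by
  rw [add_comm, app_add, app_smul, app_mul_app,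
    app_congr (a := (f ≫ a.val) • d) (b := a.res f * d) ⁅X, Y⁆ f rfl]
  group

/-- Conjugation by X_a is a group automorphism, so it carries commutators to commutators. The
coefficient of a in this identity is the Jacobi identity. -/
theorem lie_conj (X Y Z : Tangent k R G I) (a : D R I) :
    ⁅Y + a.val • ⁅X, Y⁆, Z + a.val • ⁅X, Z⁆⁆ = ⁅Y, Z⁆ + a.val • ⁅X, ⁅Y, Z⁆⁆ := by
  refine lie_eq_of_isBracket fun J f b c => ?_
  rw [← conj_app, ← conj_app, ← conj_app, app_lie]
  group

theorem leibniz_lie_aux (X Y Z : Tangent k R G I) :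
    ⁅X, ⁅Y, Z⁆⁆ = ⁅⁅X, Y⁆, Z⁆ + ⁅Y, ⁅X, Z⁆⁆ := by
  have key : ∀ {I : E} (X Y Z : Tangent k R G I) (a : D R I),
      a.val • ⁅X, ⁅Y, Z⁆⁆ = a.val • (⁅⁅X, Y⁆, Z⁆ + ⁅Y, ⁅X, Z⁆⁆) := by
    intro I X Y Z a
    have h := lie_conj X Y Z a
    rw [lie_add_aux, add_lie_aux, add_lie_aux, lie_smul_aux, lie_smul_aux, smul_lie_aux,
      smul_lie_aux, smul_smul, ← _root_.sq, a.sq, zero_smul, add_zero, add_assoc,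
      add_right_inj] at h
    rw [← h, smul_add]
  have res_add : ∀ {J : E} (g : J ⟶ I) (U V : Tangent k R G I),
      (U + V).res g = U.res g + V.res g := by
    intro J g U V
    ext K f d
    simp only [app_add, res_app]
  -- Since (aU)_b = U_{ab}, equality of the multiples by every a in D, at every stage, gives
  -- equality on all products, hence of the vectors. The factor a cannot be cancelled at a fixed
  -- stage.
  refine ext_mul fun J f a b => ?_
  have h := congrArg (fun U => U.app (𝟙 J) b) (key (X.res f) (Y.res f) (Z.res f) a)
  simp only [← res_lie, ← res_add, app_smul, res_app, Category.id_comp] at h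
  exact h

theorem eq_zero_of_add_self [CharZero k] {X : Tangent k R G I} (h : X + X = 0) : X = 0 := by
  have h2 : algebraMap k (I ⟶ R) (1 / 2) * 2 = 1 := by
    rw [← map_ofNat (algebraMap k (I ⟶ R)) 2, ← map_mul]
    norm_num
  rw [← one_smul (I ⟶ R) X, ← h2, mul_smul, two_smul, h, smul_zero]

noncomputable instance [CharZero k] : LieRing (Tangent k R G I) where
  add_lie := add_lie_aux
  lie_add := lie_add_aux
  lie_self X := eq_zero_of_add_self (add_eq_zero_iff_eq_neg.mpr (lie_skew_aux X X))
  leibniz_lie := leibniz_lie_aux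

noncomputable instance [CharZero k] : LieAlgebra (I ⟶ R) (Tangent k R G I) where
  lie_smul := lie_smul_aux

/-- Conjugation by Y_{-a} = Y_a⁻¹. Moving X_b to the right past Y_a applies 1 - a ad Y to X. -/
theorem app_mul_app_eq_conj [CharZero k] (X Y : Tangent k R G I) (a b : D R I) :
    X.app (𝟙 I) b * Y.app (𝟙 I) a = Y.app (𝟙 I) a * (X - a.val • ⁅Y, X⁆).app (𝟙 I) b := by
  have h := conj_app Y X (-a) (𝟙 I) b
  have hr : (-a).res (𝟙 I) = -a := D.ext (Category.id_comp _)
  rw [hr, app_neg_point, inv_inv, D.val_neg, neg_smul, ← sub_eq_add_neg] at h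
  rw [← h]
  group

end Tangent

/-! ### The Baker–Campbell–Hausdorff equation in an abstract Lie algebra. -/

section BCH

variable {A L : Type*} [CommRing A] [LieRing L] [LieAlgebra A L]

/-- The vector `V` for which `s • V` is the Baker–Campbell–Hausdorff series of `s • X` and `s • Y`
up to order four, where `c = 1 / 96`. -/
def bchVec (c : A) (X Y : L) (s : A) : L :=
  X + Y + (48 * c * s) • ⁅X, Y⁆ + (8 * c * s ^ 2) • ⁅⁅X, Y⁆, Y - X⁆ +
    (c * s ^ 3) • (⁅X + Y, ⁅⁅X, Y⁆, X + Y⁆⁆ + ⁅⁅⁅X, Y⁆, X - Y⁆, X - Y⁆)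

/-- The derivative of `bchVec` with respect to `s`. -/
def bchVecDeriv (c : A) (X Y : L) (s : A) : L :=
  (48 * c) • ⁅X, Y⁆ + (16 * c * s) • ⁅⁅X, Y⁆, Y - X⁆ +
    (3 * c * s ^ 2) • (⁅X + Y, ⁅⁅X, Y⁆, X + Y⁆⁆ + ⁅⁅⁅X, Y⁆, X - Y⁆, X - Y⁆)

theorem bchVec_add (c : A) (X Y : L) (s d : A) (h : d ^ 2 = 0) :
    bchVec c X Y (s + d) = bchVec c X Y s + d • bchVecDeriv c X Y s := by
  have h2 : (s + d) ^ 2 = s ^ 2 + 2 * s * d := by linear_combination h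
  have h3 : (s + d) ^ 3 = s ^ 3 + 3 * s ^ 2 * d := by linear_combination (3 * s + d) * h
  rw [bchVec, bchVec, bchVecDeriv, h2, h3]
  module

/-- ad X and ad Y commute on [X,Y], because their commutator ad [X,Y] kills it. -/
theorem lie_lie_comm_of_lie (X Y : L) : ⁅Y, ⁅X, ⁅X, Y⁆⁆⁆ = ⁅X, ⁅Y, ⁅X, Y⁆⁆⁆ := by
  rw [leibniz_lie X Y, lie_self, zero_add]

/-- With the factor 1/96 this is the familiar quartic term -1/24 [X,[Y,[X,Y]]]. -/
theorem lie_bch_quartic (X Y : L) :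
    ⁅X + Y, ⁅⁅X, Y⁆, X + Y⁆⁆ + ⁅⁅⁅X, Y⁆, X - Y⁆, X - Y⁆ = (-4 : A) • ⁅X, ⁅Y, ⁅X, Y⁆⁆⁆ := by
  rw [← lie_skew (⁅X, Y⁆) (X + Y), ← lie_skew (⁅⁅X, Y⁆, X - Y⁆), ← lie_skew (⁅X, Y⁆) (X - Y)]
  simp only [add_lie, sub_lie, lie_add, lie_sub, lie_neg, lie_lie_comm_of_lie]
  module

theorem lie_bch_cubic (X Y : L) : ⁅⁅X, Y⁆, Y - X⁆ = ⁅X, ⁅X, Y⁆⁆ - ⁅Y, ⁅X, Y⁆⁆ := by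
  rw [← lie_skew (⁅X, Y⁆) (Y - X), sub_lie, neg_sub]

/-- V and V' share the vector B because V' is the derivative of V. Hence the term s³[B,B] drops out,
and s⁴ = 0 kills everything beyond the terms listed. -/
theorem lie_truncate {s : A} (hs : s ^ 4 = 0) {U V V' V₂ B B' B₂ : L}
    (hV : V = U + s • B + s ^ 2 • V₂) (hV' : V' = B + s • B' + s ^ 2 • B₂) :
    s ^ 2 • ⁅V, V'⁆ = s ^ 2 • ⁅U, B⁆ + s ^ 3 • ⁅U, B'⁆ ∧
      s ^ 3 • ⁅V, ⁅V, V'⁆⁆ = s ^ 3 • ⁅U, ⁅U, B⁆⁆ := by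
  subst hV hV'
  simp only [add_lie, lie_add, smul_lie, lie_smul, lie_self]
  constructor <;> match_scalars <;> grind

/-- The differential equation that characterizes the Baker–Campbell–Hausdorff series up to order
four, at `s = d₁ + d₂ + d₃` with `dᵢ ^ 2 = 0`. The exponentials of `-s ad Y` and of `-s ad V` are
written as products over the `dᵢ`. -/
theorem bchVec_ode {c : A} (hc : 96 * c = 1) (X Y : L) {d₁ d₂ d₃ : A} (h₁ : d₁ ^ 2 = 0)
    (h₂ : d₂ ^ 2 = 0) (h₃ : d₃ ^ 2 = 0) {X₁ X₂ X₃ V V' V₂ V₃ : L}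
    (hX₁ : X₁ = X - d₁ • ⁅Y, X⁆) (hX₂ : X₂ = X₁ - d₂ • ⁅Y, X₁⁆) (hX₃ : X₃ = X₂ - d₃ • ⁅Y, X₂⁆)
    (hV : V = bchVec c X Y (d₁ + d₂ + d₃)) (hV' : V' = bchVecDeriv c X Y (d₁ + d₂ + d₃))
    (hV₂ : V₂ = d₁ • V' - d₂ • ⁅V, d₁ • V'⁆ + d₂ • V')
    (hV₃ : V₃ = V₂ - d₃ • ⁅V, V₂⁆ + d₃ • V') :
    X₃ + Y = V₃ + V := by
  obtain ⟨s, hs⟩ : ∃ s, s = d₁ + d₂ + d₃ := ⟨_, rfl⟩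
  have s2 : 2 * (d₁ * d₂ + d₁ * d₃ + d₂ * d₃) = s ^ 2 := by
    rw [hs]; linear_combination - h₁ - h₂ - h₃
  have s3 : 6 * (d₁ * d₂ * d₃) = s ^ 3 := by
    subst hs; grind
  have s4 : s ^ 4 = 0 := by
    subst hs; grind
  -- 48c = 1/2 and 16c = 1/6: the elementary symmetric functions of the dᵢ are the divided powers of
  -- s.
  have e2 : d₁ * d₂ + d₁ * d₃ + d₂ * d₃ = 48 * c * s ^ 2 := by
    linear_combination (48 * c) * s2 - (d₁ * d₂ + d₁ * d₃ + d₂ * d₃) * hc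
  have e3 : d₁ * d₂ * d₃ = 16 * c * s ^ 3 := by
    linear_combination (16 * c) * s3 - d₁ * d₂ * d₃ * hc
  -- X₃ = (1 - d₃ ad Y)(1 - d₂ ad Y)(1 - d₁ ad Y)X, which is e^{-s ad Y}X.
  have hX : X₃ = X + s • ⁅X, Y⁆ - (48 * c * s ^ 2) • ⁅Y, ⁅X, Y⁆⁆ +
      (16 * c * s ^ 3) • ⁅Y, ⁅Y, ⁅X, Y⁆⁆⁆ := by
    have skew : ⁅Y, X⁆ = -⁅X, Y⁆ := (lie_skew Y X).symm
    rw [hX₃, hX₂, hX₁, ← e2, ← e3, hs]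
    simp only [lie_sub, lie_smul, skew, lie_neg]
    module
  -- V₃ applies d₁(1 - d₃ ad V)(1 - d₂ ad V) + d₂(1 - d₃ ad V) + d₃ to V'; the coefficients are
  -- again elementary symmetric.
  have hW : V₃ = s • V' - (48 * c * s ^ 2) • ⁅V, V'⁆ + (16 * c * s ^ 3) • ⁅V, ⁅V, V'⁆⁆ := by
    rw [hV₃, hV₂, ← e2, ← e3, hs]
    simp only [lie_sub, lie_add, lie_smul]
    module
  rw [← hs, bchVec, lie_bch_quartic (A := A), lie_bch_cubic] at hV
  rw [← hs, bchVecDeriv, lie_bch_quartic (A := A), lie_bch_cubic] at hV'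
  obtain ⟨h2, h3⟩ := lie_truncate s4 (U := X + Y) (V := V) (V' := V')
    (B := (48 * c) • ⁅X, Y⁆) (B' := (16 * c) • (⁅X, ⁅X, Y⁆⁆ - ⁅Y, ⁅X, Y⁆⁆))
    (V₂ := (8 * c) • (⁅X, ⁅X, Y⁆⁆ - ⁅Y, ⁅X, Y⁆⁆) + (c * s) • (-4 : A) • ⁅X, ⁅Y, ⁅X, Y⁆⁆⁆)
    (B₂ := (3 * c) • (-4 : A) • ⁅X, ⁅Y, ⁅X, Y⁆⁆⁆)
    (by rw [hV]; module) (by rw [hV']; module)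
  rw [hX, hW, mul_smul _ (s ^ 2) ⁅V, _⁆, mul_smul _ (s ^ 3) ⁅V, _⁆, h2, h3, hV, hV']
  simp only [lie_sub, add_lie, lie_smul, lie_add, lie_lie_comm_of_lie]
  match_scalars <;> grind

end BCH
-- Products of values in G and induction on the number of parameters.
section

variable {k : Type w} [Field k] [CharZero k]
  {E : Type u} [Category.{v} E] [CartesianMonoidalCategory E] [BraidedCategory E]
  {R : E} [CommRingObj R] [AlgObj k R] {G : E} [GrpObj G] [Microlinear k R G] {I : E}

open Tangent

/-- First-order Taylor expansion in d. The correction (dV')_a is rewritten as (aV')_d, so that the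
corrections for different a are all values at the same d and can be merged by `app_add`. -/
theorem app_bchVec_add {c : I ⟶ R} (X Y : Tangent k R G I) (s : I ⟶ R) (a d : D R I) :
    (bchVec c X Y (s + d.val)).app (𝟙 I) a = (bchVec c X Y s).app (𝟙 I) a *
      (a.val • bchVecDeriv c X Y s).app (𝟙 I) d := by
  rw [bchVec_add _ _ _ _ _ d.sq, app_add, smul_app_comm]

/-- The inductive step from sums of three to sums of four elements of `D`. -/
theorem prod_app_eq_prod_bchVec_step {c : I ⟶ R} (hc : 96 * c = 1) (X Y : Tangent k R G I)
    (d₁ d₂ d₃ d₄ : D R I)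
    (ih : X.app (𝟙 I) d₁ * X.app (𝟙 I) d₂ * X.app (𝟙 I) d₃ *
        (Y.app (𝟙 I) d₁ * Y.app (𝟙 I) d₂ * Y.app (𝟙 I) d₃) =
      (bchVec c X Y (d₁.val + d₂.val + d₃.val)).app (𝟙 I) d₁ *
        (bchVec c X Y (d₁.val + d₂.val + d₃.val)).app (𝟙 I) d₂ *
        (bchVec c X Y (d₁.val + d₂.val + d₃.val)).app (𝟙 I) d₃) :
    X.app (𝟙 I) d₁ * X.app (𝟙 I) d₂ * X.app (𝟙 I) d₃ * X.app (𝟙 I) d₄ *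
        (Y.app (𝟙 I) d₁ * Y.app (𝟙 I) d₂ * Y.app (𝟙 I) d₃ * Y.app (𝟙 I) d₄) =
      (bchVec c X Y (d₁.val + d₂.val + d₃.val + d₄.val)).app (𝟙 I) d₁ *
        (bchVec c X Y (d₁.val + d₂.val + d₃.val + d₄.val)).app (𝟙 I) d₂ *
        (bchVec c X Y (d₁.val + d₂.val + d₃.val + d₄.val)).app (𝟙 I) d₃ *
        (bchVec c X Y (d₁.val + d₂.val + d₃.val + d₄.val)).app (𝟙 I) d₄ := by
  have ode := bchVec_ode hc X Y d₁.sq d₂.sq d₃.sq rfl rfl rfl rfl rfl rfl rfl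
  rw [app_bchVec_add X Y _ d₁, app_bchVec_add X Y _ d₂, app_bchVec_add X Y _ d₃,
    app_bchVec_add X Y _ d₄]
  generalize bchVec c X Y (d₁.val + d₂.val + d₃.val) = V at *
  generalize bchVecDeriv c X Y (d₁.val + d₂.val + d₃.val) = V' at *
  -- The factor at d₄ itself gets no correction, as d₄² = 0.
  rw [smul_app_self, mul_one]
  generalize hX₁ : X - d₁.val • ⁅Y, X⁆ = X₁ at *
  generalize hX₂ : X₁ - d₂.val • ⁅Y, X₁⁆ = X₂ at *
  generalize hX₃ : X₂ - d₃.val • ⁅Y, X₂⁆ = X₃ at *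
  have m₁ := app_mul_app_eq_conj X Y d₁ d₄
  have m₂ := app_mul_app_eq_conj X₁ Y d₂ d₄
  have m₃ := app_mul_app_eq_conj X₂ Y d₃ d₄
  rw [hX₁] at m₁
  rw [hX₂] at m₂
  rw [hX₃] at m₃
  generalize hV₂ : d₁.val • V' - d₂.val • ⁅V, d₁.val • V'⁆ + d₂.val • V' = V₂ at *
  -- The correction from d₁ passes V_{d₂} and merges with the correction from d₂; `n₃` repeats this
  -- at d₃.
  have n₂ : (d₁.val • V').app (𝟙 I) d₄ * (V.app (𝟙 I) d₂ * (d₂.val • V').app (𝟙 I) d₄) =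
      V.app (𝟙 I) d₂ * V₂.app (𝟙 I) d₄ := by
    rw [← mul_assoc, app_mul_app_eq_conj, mul_assoc, ← app_add, hV₂]
  have n₃ : V₂.app (𝟙 I) d₄ * (V.app (𝟙 I) d₃ * (d₃.val • V').app (𝟙 I) d₄) =
      V.app (𝟙 I) d₃ * (V₂ - d₃.val • ⁅V, V₂⁆ + d₃.val • V').app (𝟙 I) d₄ := by
    rw [← mul_assoc, app_mul_app_eq_conj, mul_assoc, ← app_add]
  calc _ = X.app (𝟙 I) d₁ * X.app (𝟙 I) d₂ * X.app (𝟙 I) d₃ *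
        (X.app (𝟙 I) d₄ * Y.app (𝟙 I) d₁) * Y.app (𝟙 I) d₂ * Y.app (𝟙 I) d₃ *
        Y.app (𝟙 I) d₄ := by group
    _ = X.app (𝟙 I) d₁ * X.app (𝟙 I) d₂ * X.app (𝟙 I) d₃ * Y.app (𝟙 I) d₁ *
        (X₁.app (𝟙 I) d₄ * Y.app (𝟙 I) d₂) * Y.app (𝟙 I) d₃ * Y.app (𝟙 I) d₄ := by
      rw [m₁]; group
    _ = X.app (𝟙 I) d₁ * X.app (𝟙 I) d₂ * X.app (𝟙 I) d₃ * Y.app (𝟙 I) d₁ * Y.app (𝟙 I) d₂ *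
        (X₂.app (𝟙 I) d₄ * Y.app (𝟙 I) d₃) * Y.app (𝟙 I) d₄ := by
      rw [m₂]; group
    _ = (X.app (𝟙 I) d₁ * X.app (𝟙 I) d₂ * X.app (𝟙 I) d₃ *
        (Y.app (𝟙 I) d₁ * Y.app (𝟙 I) d₂ * Y.app (𝟙 I) d₃)) *
        (X₃ + Y).app (𝟙 I) d₄ := by
      rw [m₃, app_add]; group
    _ = V.app (𝟙 I) d₁ * (V.app (𝟙 I) d₂ * (V₂.app (𝟙 I) d₄ *
        (V.app (𝟙 I) d₃ * (d₃.val • V').app (𝟙 I) d₄))) * V.app (𝟙 I) d₄ := by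
      rw [ih, ode, n₃, app_add]; group
    _ = V.app (𝟙 I) d₁ * ((d₁.val • V').app (𝟙 I) d₄ * (V.app (𝟙 I) d₂ *
        (d₂.val • V').app (𝟙 I) d₄)) *
        (V.app (𝟙 I) d₃ * (d₃.val • V').app (𝟙 I) d₄) * V.app (𝟙 I) d₄ := by
      rw [n₂]; group
    _ = _ := by group

theorem prod_app_eq_prod_bchVec {c : I ⟶ R} (hc : 96 * c = 1) (X Y : Tangent k R G I)
    (d₁ d₂ d₃ d₄ : D R I) :
    X.app (𝟙 I) d₁ * X.app (𝟙 I) d₂ * X.app (𝟙 I) d₃ * X.app (𝟙 I) d₄ *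
        (Y.app (𝟙 I) d₁ * Y.app (𝟙 I) d₂ * Y.app (𝟙 I) d₃ * Y.app (𝟙 I) d₄) =
      (bchVec c X Y (d₁.val + d₂.val + d₃.val + d₄.val)).app (𝟙 I) d₁ *
        (bchVec c X Y (d₁.val + d₂.val + d₃.val + d₄.val)).app (𝟙 I) d₂ *
        (bchVec c X Y (d₁.val + d₂.val + d₃.val + d₄.val)).app (𝟙 I) d₃ *
        (bchVec c X Y (d₁.val + d₂.val + d₃.val + d₄.val)).app (𝟙 I) d₄ := by
  have step := prod_app_eq_prod_bchVec_step hc X Y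
  -- Parameters equal to 0 contribute trivial factors, so the one step from three to four parameters
  -- also covers the shorter products.
  have h₁ := step 0 0 0 d₁ (by simp only [app_zero, mul_one])
  have h₂ := step 0 0 d₁ d₂ (by
    simpa only [app_zero, one_mul, D.val_zero, zero_add] using h₁)
  have h₃ := step 0 d₁ d₂ d₃ (by
    simpa only [app_zero, one_mul, D.val_zero, zero_add] using h₂)
  exact step d₁ d₂ d₃ d₄ (by
    simpa only [app_zero, one_mul, D.val_zero, zero_add] using h₃)

omit [CharZero k] [Microlinear k R G] in
theorem ExpMap.app_sum_smul (exp : ExpMap k R G) (X : Tangent k R G I) (d₁ d₂ d₃ d₄ : D R I) :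
    exp.app ((d₁.val + d₂.val + d₃.val + d₄.val) • X) =
      X.app (𝟙 I) d₁ * X.app (𝟙 I) d₂ * X.app (𝟙 I) d₃ * X.app (𝟙 I) d₄ := by
  simp only [exp.add_smul, exp.tangent]

end

end SDG

theorem theorem3p1 {k : Type w} [Field k] [CharZero k]
    {E : Type u} [Category.{v} E] [CartesianMonoidalCategory E] [BraidedCategory E]
    (R : E) [CommRingObj R] [SDG.AlgObj k R] [SDG.KockLawvere k R]
    (G : E) [GrpObj G] [SDG.Microlinear k R G] (exp : SDG.ExpMap k R G)
    (I : E) (X Y : SDG.Tangent k R G I) (d₁ d₂ d₃ d₄ : SDG.D R I) :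
    exp.app ((d₁.val + d₂.val + d₃.val + d₄.val) • X) *
        exp.app ((d₁.val + d₂.val + d₃.val + d₄.val) • Y) =
      exp.app ((d₁.val + d₂.val + d₃.val + d₄.val) • (X + Y) +
        ((1 / 2 : k) • (d₁.val + d₂.val + d₃.val + d₄.val) ^ 2) • ⁅X, Y⁆ +
        ((1 / 12 : k) • (d₁.val + d₂.val + d₃.val + d₄.val) ^ 3) • ⁅⁅X, Y⁆, Y - X⁆ +
        ((1 / 96 : k) • (d₁.val + d₂.val + d₃.val + d₄.val) ^ 4) •
          (⁅X + Y, ⁅⁅X, Y⁆, X + Y⁆⁆ + ⁅⁅⁅X, Y⁆, X - Y⁆, X - Y⁆)) := by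
  have hc : 96 * algebraMap k (I ⟶ R) (1 / 96) = 1 := by
    rw [← map_ofNat (algebraMap k (I ⟶ R)) 96, ← map_mul]
    norm_num
  have h2 : algebraMap k (I ⟶ R) (1 / 2) = 48 * algebraMap k (I ⟶ R) (1 / 96) := by
    rw [← map_ofNat (algebraMap k (I ⟶ R)) 48, ← map_mul]
    norm_num
  have h12 : algebraMap k (I ⟶ R) (1 / 12) = 8 * algebraMap k (I ⟶ R) (1 / 96) := by
    rw [← map_ofNat (algebraMap k (I ⟶ R)) 8, ← map_mul]
    norm_num
  -- The last rewrite reads the product over V(s) as exp(sV(s)), with s in V(s) held fixed; only the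
  -- expansion of sV(s) remains.
  rw [exp.app_sum_smul, exp.app_sum_smul, SDG.prod_app_eq_prod_bchVec hc, ← exp.app_sum_smul]
  congr 1
  rw [Algebra.smul_def, Algebra.smul_def, Algebra.smul_def, h2, h12, SDG.bchVec]
  module
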